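/- For a Lipschitz map $f:\mathbb{R}^n\to\mathbb{R}^n$ and $x\in\mathbb{R}^n$, let $$\partial f(x)=\operatorname{co}\Big\{\lim_{i\to\infty} df(x_i)\;:\; x_i\to x,\ f \text{ is differentiable at every } x_i,\ \text{and the limit exists}\Big\}$$ be the Clarke generalized differential of $f$ at $x$, where $\operatorname{co}$ denotes the convex hull and $df(x_i)$ is identified with the Jacobian matrix. Say that $\partial f(x)$ has maximal rank if every $B\in\partial f(x)$ has rank $n$, and let $\operatorname{Spec}(\partial f(x))\subset\mathbb{C}$ be the set of all complex eigenvalues of all matrices $A\in\partial f(x)$. Let $f:\mathbb{R}^n\to\mathbb{R}^n$ be a (globally) Lipschitz map such that $\partial f(x)$ has maximal rank for every $x\in\mathbb{R}^n$, and suppose that there is some $\varepsilon>0$ such that $$\operatorname{Spec}(\partial f(x))\cap\{z\in\mathbb{C}:|z|\le\varepsilon\}=\emptyset\qquad\text{for all } x\in\mathbb{R}^n.$$ Then $f$ is a global homeomorphism, that is, a homeomorphism of $\mathbb{R}^n$ onto $\mathbb{R}^n$. -/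

import Mathlib

open Filter Topology

/-- The Clarke generalized differential of `f : ℝᵐ → ℝⁿ` at `x`: the convex hull of all limits
`lim df(xᵢ)` along sequences `xᵢ → x` of points at which `f` is differentiable. -/
def clarkeDifferential {m n : ℕ} (f : EuclideanSpace ℝ (Fin m) → EuclideanSpace ℝ (Fin n))
    (x : EuclideanSpace ℝ (Fin m)) :
    Set (EuclideanSpace ℝ (Fin m) →L[ℝ] EuclideanSpace ℝ (Fin n)) :=
  convexHull ℝ {L | ∃ u : ℕ → EuclideanSpace ℝ (Fin m),
    Tendsto u atTop (𝓝 x) ∧ (∀ i, DifferentiableAt ℝ f (u i)) ∧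
      Tendsto (fun i => fderiv ℝ f (u i)) atTop (𝓝 L)}

/-- A family of linear endomorphisms of `ℝⁿ` has maximal rank if every element has rank `n`. -/
def HasMaximalRank {n : ℕ}
    (S : Set (EuclideanSpace ℝ (Fin n) →L[ℝ] EuclideanSpace ℝ (Fin n))) : Prop :=
  ∀ B ∈ S, LinearMap.rank (B : EuclideanSpace ℝ (Fin n) →ₗ[ℝ] EuclideanSpace ℝ (Fin n)) = n

/-- The real matrix of a linear endomorphism of `ℝⁿ` in the standard basis. -/
noncomputable def standardMatrix {n : ℕ}
    (A : EuclideanSpace ℝ (Fin n) →L[ℝ] EuclideanSpace ℝ (Fin n)) :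
    Matrix (Fin n) (Fin n) ℝ :=
  LinearMap.toMatrix (EuclideanSpace.basisFun (Fin n) ℝ).toBasis
    (EuclideanSpace.basisFun (Fin n) ℝ).toBasis
    (A : EuclideanSpace ℝ (Fin n) →ₗ[ℝ] EuclideanSpace ℝ (Fin n))

/-- All complex eigenvalues of all (matrices of) elements of a family of linear endomorphisms
of `ℝⁿ`; the matrices act on `ℂⁿ`. -/
def complexSpec {n : ℕ}
    (S : Set (EuclideanSpace ℝ (Fin n) →L[ℝ] EuclideanSpace ℝ (Fin n))) : Set ℂ :=
  {z | ∃ A ∈ S, Module.End.HasEigenvalue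
    (Matrix.toLin' ((standardMatrix A).map (fun r : ℝ => (r : ℂ)))) z}

/-! The spectral gap bounds `|det A|` below by `ε ^ n`, and the Lipschitz constant bounds `‖A‖`; by
compactness all Clarke matrices, at all points, share one lower bound `c * ‖v‖ ≤ ‖A v‖`, and so do
their adjoints.

For fixed `v` the vectors `A v`, `A ∈ ∂f(x)`, form a convex set outside the ball of radius `c`, so a
single unit `w` satisfies `c ≤ ⟪w, A v⟫` for all of them. Rademacher's theorem and an averaged mean
value inequality turn this into local expansion (`exists_ball_local_expansion`). The same argument
for the adjoints lets `f` move at a definite rate in any prescribed direction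
(`exists_directional_ascent`). Minimising a penalised residual then solves `f z = y` with `‖z - x‖`
linearly controlled by `‖f x - y‖`.

Thus `f` is an open local homeomorphism with uniform constants. Segments lift with controlled
length, and lifting all segments from one base point produces a continuous global inverse. -/

/-! ### Determinant bounds from the spectrum. -/

theorem Matrix.pow_card_le_norm_det {n : Type*} [Fintype n] [DecidableEq n] (M : Matrix n n ℂ)
    {ε : ℝ} (hε : 0 ≤ ε) (h : ∀ z, Module.End.HasEigenvalue (Matrix.toLin' M) z → ε ≤ ‖z‖) :
    ε ^ Fintype.card n ≤ ‖M.det‖ := by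
  have hcard : M.charpoly.roots.card = Fintype.card n := by
    rw [← M.charpoly_natDegree_eq_dim]
    exact (IsAlgClosed.splits M.charpoly).natDegree_eq_card_roots.symm
  have hprod : ‖M.charpoly.roots.prod‖ = (M.charpoly.roots.map norm).prod :=
    map_multiset_prod (normHom : ℂ →*₀ ℝ) _
  -- Over `ℂ` the determinant is the product of `n` eigenvalues with multiplicity, each of modulus
  -- at least `ε`.
  rw [M.det_eq_prod_roots_charpoly, hprod, ← hcard]
  calc ε ^ M.charpoly.roots.card = (M.charpoly.roots.map fun _ => ε).prod := by simp
    _ ≤ _ := Multiset.prod_map_le_prod_map₀ _ _ (fun _ _ => hε) fun z hz => h z <| by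
      rw [Module.End.hasEigenvalue_iff_isRoot_charpoly, Matrix.charpoly_toLin']
      exact Polynomial.isRoot_of_mem_roots hz

theorem pow_le_abs_det_of_complexSpec {n : ℕ}
    {S : Set (EuclideanSpace ℝ (Fin n) →L[ℝ] EuclideanSpace ℝ (Fin n))} {ε : ℝ} (hε : 0 ≤ ε)
    (hS : complexSpec S ∩ {z : ℂ | ‖z‖ ≤ ε} = ∅) {A} (hA : A ∈ S) : ε ^ n ≤ |A.det| := by
  have h := Matrix.pow_card_le_norm_det ((standardMatrix A).map (fun r : ℝ => (r : ℂ))) hε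
    fun z hz => by
      by_contra! hlt
      exact (Set.eq_empty_iff_forall_notMem.1 hS z) ⟨⟨A, hA, hz⟩, hlt.le⟩
  have hdet : ((standardMatrix A).map (fun r : ℝ => (r : ℂ))).det = ((A.det : ℝ) : ℂ) := by
    have h1 : (standardMatrix A).det = A.det := LinearMap.det_toMatrix _ _
    rw [← h1]
    exact (RingHom.map_det Complex.ofRealHom (standardMatrix A)).symm
  rw [hdet, Complex.norm_real, Fintype.card_fin] at h
  exact h

/-! ### Uniform lower bounds and convex separation. -/

section LinearMaps

variable {E : Type*} [NormedAddCommGroup E] [InnerProductSpace ℝ E] [FiniteDimensional ℝ E]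

theorem ContinuousLinearMap.surjective_of_det_ne_zero {A : E →L[ℝ] E} (hA : A.det ≠ 0) :
    Function.Surjective A :=
  (A.toContinuousLinearEquivOfDetNeZero hA).surjective

theorem ContinuousLinearMap.injective_of_det_ne_zero {A : E →L[ℝ] E} (hA : A.det ≠ 0) :
    Function.Injective A :=
  (A.toContinuousLinearEquivOfDetNeZero hA).injective

/-- Operators of bounded norm whose determinants are bounded away from zero are uniformly bounded
below. -/
theorem exists_forall_mul_norm_le_of_det (K : ℝ) {δ : ℝ} (hδ : 0 < δ) :
    ∃ c > 0, ∀ A : E →L[ℝ] E, ‖A‖ ≤ K → δ ≤ |A.det| → ∀ v, c * ‖v‖ ≤ ‖A v‖ := by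
  have hcomp : IsCompact (({A : E →L[ℝ] E | ‖A‖ ≤ K} ∩ {A | δ ≤ |A.det|}) ×ˢ
      Metric.sphere (0 : E) 1) := by
    refine IsCompact.prod (IsCompact.inter_right ?_ ?_) (isCompact_sphere _ _)
    · simpa [Metric.closedBall, dist_zero_right] using
        isCompact_closedBall (0 : E →L[ℝ] E) K
    · exact isClosed_le continuous_const ContinuousLinearMap.continuous_det.abs
  obtain hemp | hne := Set.eq_empty_or_nonempty (({A : E →L[ℝ] E | ‖A‖ ≤ K} ∩
    {A | δ ≤ |A.det|}) ×ˢ Metric.sphere (0 : E) 1)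
  · refine ⟨1, one_pos, fun A hA hdet v => ?_⟩
    by_cases hv : v = 0
    · simp [hv]
    · have : (A, ‖v‖⁻¹ • v) ∈ (∅ : Set ((E →L[ℝ] E) × E)) := by
        rw [← hemp]
        exact ⟨⟨hA, hdet⟩, by simp [norm_smul, hv]⟩
      exact this.elim
  -- The minimum over this compact set is positive, since the minimising operator has nonzero
  -- determinant and is injective.
  · obtain ⟨⟨B, w⟩, ⟨⟨-, hB⟩, hw⟩, hmin⟩ := hcomp.exists_isMinOn hne
      (f := fun p : (E →L[ℝ] E) × E => ‖p.1 p.2‖) (by fun_prop)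
    have hBdet : B.det ≠ 0 := fun h0 => by
      rw [Set.mem_ofPred_eq, h0, abs_zero] at hB
      exact hB.not_gt hδ
    have hw0 : w ≠ 0 := by
      rintro rfl
      simp at hw
    refine ⟨‖B w‖, norm_pos_iff.2 fun h0 => hw0 <|
      ContinuousLinearMap.injective_of_det_ne_zero hBdet (by simpa using h0),
      fun A hA hdet v => ?_⟩
    by_cases hv : v = 0
    · simp [hv]
    · have hmem : (A, ‖v‖⁻¹ • v) ∈ (({A : E →L[ℝ] E | ‖A‖ ≤ K} ∩ {A | δ ≤ |A.det|}) ×ˢ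
          Metric.sphere (0 : E) 1) := ⟨⟨hA, hdet⟩, by simp [norm_smul, hv]⟩
      have h := isMinOn_iff.1 hmin _ hmem
      simp only [map_smul, norm_smul, norm_inv, norm_norm] at h
      rwa [inv_mul_eq_div, le_div_iff₀ (norm_pos_iff.2 hv)] at h

/-- For `w = A v`, Cauchy–Schwarz gives `‖w‖² = ⟪v, A* w⟫ ≤ ‖v‖ ‖A* w‖`, and `‖v‖ ≤ ‖w‖ / c`. -/
theorem ContinuousLinearMap.mul_norm_le_norm_adjoint {A : E →L[ℝ] E} {c : ℝ} (hc : 0 < c)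
    (hsurj : Function.Surjective A) (hA : ∀ v, c * ‖v‖ ≤ ‖A v‖) (w : E) :
    c * ‖w‖ ≤ ‖A.adjoint w‖ := by
  obtain ⟨v, rfl⟩ := hsurj w
  obtain h0 | h0 := (norm_nonneg (A v)).eq_or_lt
  · rw [← h0, mul_zero]
    positivity
  · have h1 : ‖A v‖ * ‖A v‖ ≤ ‖v‖ * ‖A.adjoint (A v)‖ := by
      rw [← real_inner_self_eq_norm_mul_norm, ← A.adjoint_inner_right]
      exact real_inner_le_norm _ _
    have h2 : c * ‖A v‖ * ‖A v‖ ≤ ‖A.adjoint (A v)‖ * ‖A v‖ := by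
      nlinarith [mul_le_mul_of_nonneg_right (hA v) (norm_nonneg (A.adjoint (A v)))]
    exact le_of_mul_le_mul_right h2 h0

/-- A convex set avoiding an open ball about the origin is separated from it by a unit vector. -/
theorem Convex.exists_unit_forall_le_inner [Nontrivial E] {C : Set E} (hC : Convex ℝ C) {c : ℝ}
    (hc : 0 < c) (h : ∀ u ∈ C, c ≤ ‖u‖) : ∃ w : E, ‖w‖ = 1 ∧ ∀ u ∈ C, c ≤ inner ℝ w u := by
  obtain rfl | hne := C.eq_empty_or_nonempty
  · obtain ⟨w, hw⟩ := exists_norm_eq E zero_le_one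
    exact ⟨w, hw, by simp⟩
  -- Take `p` to be the point of the closure nearest to `0`; its variational inequality says `‖p‖² ≤
  -- ⟪p, u⟫` on `C`.
  obtain ⟨p, hp, hmin⟩ := exists_norm_eq_iInf_of_complete_convex hne.closure
    isClosed_closure.isComplete hC.closure 0
  rw [norm_eq_iInf_iff_real_inner_le_zero hC.closure hp] at hmin
  have hcp : c ≤ ‖p‖ := closure_minimal h (isClosed_le continuous_const continuous_norm) hp
  have hp0 : 0 < ‖p‖ := hc.trans_le hcp
  refine ⟨‖p‖⁻¹ • p, by simp [norm_smul, hp0.ne'], fun u hu => ?_⟩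
  have h1 := hmin u (subset_closure hu)
  rw [zero_sub, inner_neg_left, inner_sub_right, real_inner_self_eq_norm_mul_norm] at h1
  rw [real_inner_smul_left, inv_mul_eq_div, le_div_iff₀ hp0]
  nlinarith

end LinearMaps

/-! ### Boundedness and semicontinuity of the Clarke differential. -/

section Clarke

variable {m n : ℕ} {f : EuclideanSpace ℝ (Fin m) → EuclideanSpace ℝ (Fin n)}

theorem norm_le_of_mem_clarkeDifferential {K : NNReal} (hf : LipschitzWith K f)
    {x : EuclideanSpace ℝ (Fin m)} {A} (hA : A ∈ clarkeDifferential f x) : ‖A‖ ≤ K := by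
  have : clarkeDifferential f x ⊆ Metric.closedBall 0 K := by
    refine convexHull_min ?_ (convex_closedBall _ _)
    rintro L ⟨u, -, -, hu⟩
    refine Metric.isClosed_closedBall.mem_of_tendsto hu (Eventually.of_forall fun i => ?_)
    simpa using norm_fderiv_le_of_lipschitz ℝ hf
  simpa using this hA

/-- Upper semicontinuity of the Clarke differential along points of differentiability. -/
theorem exists_ball_fderiv_near_clarkeDifferential {K : NNReal} (hf : LipschitzWith K f)
    (x : EuclideanSpace ℝ (Fin m)) {η : ℝ} (hη : 0 < η) :
    ∃ r > 0, ∀ y ∈ Metric.ball x r, DifferentiableAt ℝ f y →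
      ∃ A ∈ clarkeDifferential f x, ‖fderiv ℝ f y - A‖ < η := by
  by_contra! hcon
  choose u hu hdiff hfar using fun i : ℕ => hcon (1 / ((i : ℝ) + 1)) Nat.one_div_pos_of_nat
  have hux : Tendsto u atTop (𝓝 x) := by
    rw [tendsto_iff_dist_tendsto_zero]
    exact squeeze_zero (fun _ => dist_nonneg) (fun i => (Metric.mem_ball.1 (hu i)).le)
      tendsto_one_div_add_atTop_nhds_zero_nat
  -- The derivatives are bounded by `K`, so a subsequence converges, and its limit is one of the
  -- generators of the Clarke differential.
  obtain ⟨A, -, φ, hφ, hA⟩ := (isCompact_closedBall (0 : EuclideanSpace ℝ (Fin m) →L[ℝ]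
    EuclideanSpace ℝ (Fin n)) K).tendsto_subseq (x := fun i => fderiv ℝ f (u i))
    fun i => by simpa using norm_fderiv_le_of_lipschitz ℝ hf
  have hmem : A ∈ clarkeDifferential f x :=
    subset_convexHull ℝ _ ⟨u ∘ φ, hux.comp hφ.tendsto_atTop, fun i => hdiff _, hA⟩
  obtain ⟨i, hi⟩ := ((tendsto_iff_norm_sub_tendsto_zero.1 hA).eventually_lt_const hη).exists
  exact (hfar (φ i) A hmem).not_gt hi

end Clarke

/-! ### Mean value inequality with almost everywhere derivative bounds. -/

section MeanValue

open MeasureTheory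

variable {E F : Type*} [NormedAddCommGroup E] [NormedSpace ℝ E] [FiniteDimensional ℝ E]
  [MeasurableSpace E] [BorelSpace E]

/-- Mean value inequality for a Lipschitz function whose derivative in the direction `v` is bounded
below almost everywhere. -/
theorem LipschitzWith.le_sub_of_ae_le_fderiv (μ : Measure E) [μ.IsAddHaarMeasure]
    {φ : E → ℝ} {K : NNReal} (hφ : LipschitzWith K φ)
    {s : Set E} (hso : IsOpen s) (hsc : Convex ℝ s) {v : E} {c : ℝ}
    (h : ∀ᵐ y ∂μ, y ∈ s → c ≤ fderiv ℝ φ y v) {x : E} (hx : x ∈ s) (hxv : x + v ∈ s) :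
    c ≤ φ (x + v) - φ x := by
  by_contra! hlt
  obtain ⟨c', hc', hc'c⟩ := exists_between hlt
  -- The segment from `x` may lie in the null set where the bound fails. The failing inequality
  -- persists for nearby starting points, so averaging over a ball of them avoids this set.
  have hev : ∀ᶠ y in 𝓝 x, y ∈ s ∧ y + v ∈ s ∧ φ (y + v) - φ y < c' := by
    have hcont := hφ.continuous
    have h1 : ∀ᶠ y in 𝓝 x, y ∈ s := hso.mem_nhds hx
    have h2 : ∀ᶠ y in 𝓝 x, y + v ∈ s :=
      (show ContinuousAt (fun y => y + v) x by fun_prop) (hso.mem_nhds hxv)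
    have h3 : ContinuousAt (fun y => φ (y + v) - φ y) x := by fun_prop
    exact h1.and (h2.and (h3.eventually_lt_const hc'))
  obtain ⟨ρ, hρ, hball⟩ := Metric.eventually_nhds_iff_ball.1 hev
  set B := Metric.ball x ρ with hB
  have hfin : μ B ≠ ⊤ := measure_ball_lt_top.ne
  have hpos : 0 < μ.real B := ENNReal.toReal_pos (Metric.measure_ball_pos μ x hρ).ne' hfin
  have : IsFiniteMeasure (μ.restrict B) := ⟨by simpa using hfin.lt_top⟩
  have hint : ∀ t : ℝ, Integrable (fun y => φ (y + t • v)) (μ.restrict B) := fun t => by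
    have hcont : Continuous fun y => φ (y + t • v) := hφ.continuous.comp (by fun_prop)
    exact (hcont.continuousOn.integrableOn_compact
      (isCompact_closedBall x ρ)).mono_set Metric.ball_subset_closedBall
  have hmem : ∀ y ∈ B, ∀ t ∈ Set.Icc (0 : ℝ) 1, y + t • v ∈ s := fun y hy t ht => by
    have := hsc.add_smul_sub_mem (hball y hy).1 (hball y hy).2.1 ht
    simpa using this
  -- Differentiation under the integral is legitimate because, for each `t`, translation by `t • v`
  -- preserves null sets and the difference quotients are dominated by `K * ‖v‖`.
  have hderiv : ∀ t : ℝ, Integrable (fun y => fderiv ℝ φ (y + t • v) v) (μ.restrict B) ∧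
      HasDerivAt (fun t : ℝ => ∫ y in B, φ (y + t • v) ∂μ)
        (∫ y in B, fderiv ℝ φ (y + t • v) v ∂μ) t := fun t => by
    refine hasDerivAt_integral_of_dominated_loc_of_lip (s := Set.univ)
      (bound := fun _ => K * ‖v‖) univ_mem
      (Eventually.of_forall fun t => (hint t).aestronglyMeasurable) (hint t) ?_ ?_
      (integrable_const _) ?_
    · exact ((measurable_fderiv_apply_const ℝ φ v).comp
        (measurable_add_const (t • v))).aestronglyMeasurable
    · refine Eventually.of_forall fun y => LipschitzOnWith.of_dist_le_mul fun a _ b _ => ?_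
      refine (hφ.dist_le_mul _ _).trans_eq ?_
      rw [dist_add_left, dist_eq_norm, ← sub_smul, norm_smul, Real.coe_nnabs,
        abs_of_nonneg (by positivity), Real.dist_eq, Real.norm_eq_abs]
      ring
    · refine ae_restrict_of_ae ?_
      filter_upwards [(quasiMeasurePreserving_add_right μ (t • v)).ae
        (hφ.ae_differentiableAt (μ := μ))] with y hy
      have hline : HasDerivAt (fun t : ℝ => y + t • v) v t := by
        simpa using ((hasDerivAt_id t).smul_const v).const_add y
      exact hy.hasFDerivAt.comp_hasDerivAt t hline
  have hmono := (convex_Icc (0 : ℝ) 1).mul_sub_le_image_sub_of_le_deriv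
    (f := fun t : ℝ => ∫ y in B, φ (y + t • v) ∂μ) (C := c * μ.real B)
    (fun t _ => (hderiv t).2.continuousAt.continuousWithinAt)
    (fun t _ => (hderiv t).2.differentiableAt.differentiableWithinAt)
    (fun t ht => by
      rw [interior_Icc] at ht
      rw [(hderiv t).2.deriv, mul_comm, ← smul_eq_mul, ← setIntegral_const]
      refine setIntegral_mono_on_ae (integrable_const _) (hderiv t).1
        Metric.isOpen_ball.measurableSet ?_
      filter_upwards [(quasiMeasurePreserving_add_right μ (t • v)).ae h] with y hy hyB
      exact hy (hmem y hyB t (Set.Ioo_subset_Icc_self ht)))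
    0 (by simp) 1 (by simp) zero_le_one
  have hupper : ∫ y in B, (φ (y + (1 : ℝ) • v) - φ (y + (0 : ℝ) • v)) ∂μ ≤ c' * μ.real B := by
    rw [mul_comm, ← smul_eq_mul, ← setIntegral_const]
    refine setIntegral_mono_on ((hint 1).sub (hint 0)) (integrable_const _)
      Metric.isOpen_ball.measurableSet fun y hy => ?_
    simpa using (hball y hy).2.2.le
  rw [integral_sub (hint 1) (hint 0)] at hupper
  rw [sub_zero, mul_one] at hmono
  exact (mul_lt_mul_of_pos_right hc'c hpos).not_ge (hmono.trans hupper)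

end MeanValue

/-! ### Quantitative surjectivity and local homeomorphism. -/

/-- A Lipschitz map which from every point can be moved in every direction at rate `b` is
surjective, with solutions of `f z = y` at a distance controlled by the defect. -/
theorem exists_eq_of_directional_ascent {E : Type*} [NormedAddCommGroup E]
    [InnerProductSpace ℝ E] [FiniteDimensional ℝ E]
    {f : E → E} {K : NNReal} (hf : LipschitzWith K f) {a b : ℝ} (ha : 0 < a) (hab : a < b)
    (hdir : ∀ x w : E, ‖w‖ = 1 → ∃ v : E, ‖v‖ = 1 ∧ ∃ r > 0, ∀ t ∈ Set.Ioo (0 : ℝ) r,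
      b * t ≤ inner ℝ w (f (x + t • v) - f x)) (x y : E) :
    ∃ z, f z = y ∧ a * ‖z - x‖ ≤ ‖f x - y‖ := by
  have hcont := hf.continuous
  -- The penalty makes the functional coercive, so a minimiser exists. If its residual were nonzero,
  -- a step against it would lower the residual at a rate exceeding the penalty's slope `a`.
  obtain ⟨z, hz⟩ := Continuous.exists_forall_le (f := fun z => ‖f z - y‖ + a * ‖z - x‖)
    (by fun_prop) (by
      refine tendsto_atTop_mono (fun _ => le_add_of_nonneg_left (norm_nonneg _))
        (Tendsto.const_mul_atTop ha ?_)
      simpa [Function.comp_def, sub_eq_add_neg] using (tendsto_norm_cocompact_atTop (E := E)).comp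
        (Homeomorph.addRight (-x)).isClosedEmbedding.tendsto_cocompact)
  by_cases hzy : f z = y
  · refine ⟨z, hzy, ?_⟩
    simpa [hzy] using hz x
  exfalso
  set u := f z - y with hu
  have hu0 : 0 < ‖u‖ := norm_pos_iff.2 (sub_ne_zero.2 hzy)
  obtain ⟨v, hv, r, hr, hvr⟩ := hdir z (-(‖u‖⁻¹ • u)) (by simp [norm_smul, hu0.ne'])
  -- The second condition allows comparison of squares with `‖u‖ - a * t`; the third absorbs `‖d‖² ≤
  -- K² t²` into the gap `2 (b - a) t ‖u‖`.
  have hsmall : ∀ᶠ t in 𝓝[>] (0 : ℝ), t < r ∧ a * t < ‖u‖ ∧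
      (K : ℝ) ^ 2 * t < 2 * (b - a) * ‖u‖ := by
    have h0 : (0 : ℝ) < 2 * (b - a) * ‖u‖ := by
      have := sub_pos.2 hab
      positivity
    refine (Filter.Eventually.and ?_ (Filter.Eventually.and ?_ ?_)).filter_mono
      nhdsWithin_le_nhds
    · exact eventually_lt_nhds hr
    · exact (show ContinuousAt (fun t : ℝ => a * t) 0 by fun_prop).eventually_lt_const
        (by simpa using hu0)
    · exact (show ContinuousAt (fun t : ℝ => (K : ℝ) ^ 2 * t) 0 by fun_prop).eventually_lt_const
        (by simpa using h0)
  obtain ⟨t, ⟨htr, hta, htK⟩, ht0⟩ := (hsmall.and self_mem_nhdsWithin).exists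
  replace ht0 : 0 < t := ht0
  set d := f (z + t • v) - f z with hd
  have hdK : ‖d‖ ≤ K * t := by
    have := hf.dist_le_mul (z + t • v) z
    rwa [dist_eq_norm, dist_eq_norm, add_sub_cancel_left, norm_smul, hv, mul_one,
      Real.norm_of_nonneg ht0.le] at this
  have hud : inner ℝ u d ≤ -(b * t * ‖u‖) := by
    have := hvr t ⟨ht0, htr⟩
    rw [← hd, inner_neg_left, real_inner_smul_left, inv_mul_eq_div, ← neg_div,
      le_div_iff₀ hu0] at this
    linarith
  have hnorm : ‖u + d‖ < ‖u‖ - a * t := by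
    refine lt_of_pow_lt_pow_left₀ 2 (sub_nonneg.2 hta.le) ?_
    rw [norm_add_sq_real]
    have h1 : ‖d‖ ^ 2 ≤ (K * t) ^ 2 := by gcongr
    nlinarith [mul_lt_mul_of_pos_right htK ht0, sq_nonneg (a * t)]
  have hzt := hz (z + t • v)
  have h2 : ‖z + t • v - x‖ ≤ ‖z - x‖ + t := by
    calc ‖z + t • v - x‖ = ‖(z - x) + t • v‖ := by congr 1; abel
      _ ≤ ‖z - x‖ + ‖t • v‖ := norm_add_le _ _
      _ = ‖z - x‖ + t := by rw [norm_smul, hv, mul_one, Real.norm_of_nonneg ht0.le]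
  have h3 : f (z + t • v) - y = u + d := by rw [hu, hd]; abel
  simp only [h3] at hzt
  nlinarith [mul_le_mul_of_nonneg_left h2 ha.le]

theorem isOpenMap_of_exists_eq {E : Type*} [NormedAddCommGroup E] {f : E → E} {a : ℝ}
    (ha : 0 < a)
    (hsol : ∀ x y, ∃ z, f z = y ∧ a * ‖z - x‖ ≤ ‖f x - y‖) : IsOpenMap f := by
  rw [isOpenMap_iff_nhds_le]
  intro x U hU
  obtain ⟨r, hr, hrU⟩ := Metric.mem_nhds_iff.1 (mem_map.1 hU)
  refine Metric.mem_nhds_iff.2 ⟨a * r, by positivity, fun y hy => ?_⟩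
  obtain ⟨z, rfl, hz⟩ := hsol x y
  refine hrU (mem_ball_iff_norm.2 (lt_of_mul_lt_mul_left ?_ ha.le))
  exact hz.trans_lt (mem_ball_iff_norm'.1 hy)

theorem isLocalHomeomorph_of_local_expansion {E : Type*} [NormedAddCommGroup E] {f : E → E}
    {a : ℝ} (ha : 0 < a) (hf : Continuous f) (hopen : IsOpenMap f)
    (hloc : ∀ x, ∃ r > 0, ∀ y ∈ Metric.ball x r, ∀ z ∈ Metric.ball x r,
      a * ‖y - z‖ ≤ ‖f y - f z‖) : IsLocalHomeomorph f := by
  rw [isLocalHomeomorph_iff_isOpenEmbedding_restrict]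
  intro x
  obtain ⟨r, hr, hexp⟩ := hloc x
  refine ⟨_, Metric.ball_mem_nhds x hr, .of_continuous_injective_isOpenMap
    (hf.comp continuous_subtype_val) ?_
    (hopen.comp Metric.isOpen_ball.isOpenMap_subtype_val)⟩
  rintro ⟨y, hy⟩ ⟨z, hz⟩ hyz
  have hyz' : f y = f z := hyz
  have h := hexp y hy z hz
  rw [hyz', sub_self, norm_zero] at h
  exact Subtype.ext (sub_eq_zero.1 (norm_le_zero_iff.1 (nonpos_of_mul_nonpos_right h ha)))

/-! ### Segment lifting and global inversion. -/

/-- Lifting of segments through a uniformly expanding map. -/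
theorem exists_segment_lift {E : Type*} [NormedAddCommGroup E] [NormedSpace ℝ E]
    [FiniteDimensional ℝ E] {f : E → E} {a : ℝ} (ha : 0 < a)
    (hsol : ∀ x y, ∃ z, f z = y ∧ a * ‖z - x‖ ≤ ‖f x - y‖)
    (hloc : ∀ x, ∃ r > 0, ∀ y ∈ Metric.ball x r, ∀ z ∈ Metric.ball x r,
      a * ‖y - z‖ ≤ ‖f y - f z‖) (x v : E) :
    ∃ g : ℝ → E, ContinuousOn g (Set.Icc 0 1) ∧ g 0 = x ∧
      ∀ t ∈ Set.Icc (0 : ℝ) 1, f (g t) = f x + t • v := by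
  choose r hr hexp using hloc
  -- Lifts over `[0, 1]` stay in this compact ball by the distance bound carried in `P`, so a
  -- Lebesgue number gives one expansion radius for every step.
  obtain ⟨δ, hδ, hleb⟩ := lebesgue_number_lemma_of_metric
    (isCompact_closedBall x (‖v‖ / a)) (fun z : E => Metric.isOpen_ball (x := z) (ε := r z))
    fun z _ => Set.mem_iUnion.2 ⟨z, Metric.mem_ball_self (hr z)⟩
  have hexpδ : ∀ x' ∈ Metric.closedBall x (‖v‖ / a), ∀ y ∈ Metric.ball x' δ,
      ∀ z ∈ Metric.ball x' δ, a * ‖y - z‖ ≤ ‖f y - f z‖ := fun x' hx' y hy z hz => by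
    obtain ⟨i, hi⟩ := hleb x' hx'
    exact hexp i y (hi hy) z (hi hz)
  let P : ℝ → Prop := fun s => ∃ g : ℝ → E, ContinuousOn g (Set.Icc 0 s) ∧ g 0 = x ∧
    ∀ t ∈ Set.Icc 0 s, f (g t) = f x + t • v ∧ a * ‖g t - x‖ ≤ t * ‖v‖
  have step : ∀ s s', 0 ≤ s → s ≤ s' → s ≤ 1 → (s' - s) * ‖v‖ < a * δ → P s → P s' := by
    rintro s s' hs hss' hs1 hlt ⟨g, hgc, hg0, hg⟩
    obtain ⟨hfgs, hgs⟩ := hg s ⟨hs, le_rfl⟩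
    have hgK : g s ∈ Metric.closedBall x (‖v‖ / a) := by
      rw [mem_closedBall_iff_norm, le_div_iff₀' ha]
      exact hgs.trans (mul_le_of_le_one_left (norm_nonneg _) hs1)
    choose h hfh hh using hsol (g s)
    have hdist : ∀ t ∈ Set.Icc s s', a * ‖h (f x + t • v) - g s‖ ≤ (t - s) * ‖v‖ :=
      fun t ht => by
        refine (hh _).trans_eq ?_
        rw [hfgs, add_sub_add_left_eq_sub, ← sub_smul, norm_smul, Real.norm_eq_abs, abs_sub_comm,
          abs_of_nonneg (sub_nonneg.2 ht.1)]
    have hball : ∀ t ∈ Set.Icc s s', h (f x + t • v) ∈ Metric.ball (g s) δ := fun t ht => by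
      refine mem_ball_iff_norm.2 (lt_of_mul_lt_mul_left ((hdist t ht).trans_lt ?_) ha.le)
      refine lt_of_le_of_lt ?_ hlt
      gcongr
      exact ht.2
    have hhs : h (f x + s • v) = g s := by
      have := hdist s ⟨le_rfl, hss'⟩
      rw [sub_self, zero_mul] at this
      exact sub_eq_zero.1 (norm_le_zero_iff.1 (nonpos_of_mul_nonpos_right this ha))
    -- The chosen solutions all lie in one ball of radius `δ`, where expansion makes the local
    -- inverse Lipschitz, whatever choice was made.
    have hhc : ContinuousOn (fun t => h (f x + t • v)) (Set.Icc s s') := by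
      refine (LipschitzOnWith.of_dist_le_mul (K := (‖v‖ / a).toNNReal)
        fun t ht t' ht' => ?_).continuousOn
      have := hexpδ _ hgK _ (hball t ht) _ (hball t' ht')
      rw [hfh, hfh, add_sub_add_left_eq_sub, ← sub_smul, norm_smul] at this
      rw [Real.coe_toNNReal _ (by positivity), dist_eq_norm, dist_eq_norm, div_mul_eq_mul_div,
        le_div_iff₀' ha]
      linarith
    refine ⟨fun t => if t ≤ s then g t else h (f x + t • v), ?_, by simp [hs, hg0], ?_⟩
    · rw [← Set.Icc_union_Icc_eq_Icc hs hss']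
      refine ContinuousOn.union_of_isClosed ?_ ?_ isClosed_Icc isClosed_Icc
      · exact hgc.congr fun t ht => if_pos ht.2
      · refine hhc.congr fun t ht => ?_
        obtain rfl | hlt := ht.1.eq_or_lt
        · simp [hhs]
        · exact if_neg hlt.not_ge
    · intro t ht
      by_cases hts : t ≤ s
      · simpa only [if_pos hts] using hg t ⟨ht.1, hts⟩
      · simp only [if_neg hts]
        refine ⟨hfh _, ?_⟩
        have h1 := hdist t ⟨(not_le.1 hts).le, ht.2⟩
        have h2 := norm_sub_le_norm_sub_add_norm_sub (h (f x + t • v)) (g s) x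
        nlinarith [mul_le_mul_of_nonneg_left h2 ha.le]
  -- With `N` equal steps each advances by `‖v‖ / N < a * δ`, as `step` requires.
  obtain ⟨N, hN⟩ := exists_nat_gt (‖v‖ / (a * δ))
  have hNpos : (0 : ℝ) < N := lt_of_le_of_lt (by positivity) hN
  have hind : ∀ k : ℕ, k ≤ N → P (k / N) := by
    intro k
    induction k with
    | zero => exact fun _ => ⟨fun _ => x, continuousOn_const, rfl, fun t ht => by
        obtain rfl : t = 0 := by simpa using ht
        simp⟩
    | succ k ih =>
      intro hk
      refine step (k / N) _ (by positivity) (by gcongr; simp) ?_ ?_ (ih (by omega))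
      · rw [div_le_one hNpos]
        exact_mod_cast (by omega : k ≤ N)
      · have : (((k + 1 : ℕ) : ℝ) / N - k / N) = 1 / N := by
          push_cast
          ring
        rw [this, one_div, inv_mul_eq_div, div_lt_iff₀ hNpos]
        rwa [div_lt_iff₀' (by positivity)] at hN
  obtain ⟨g, hgc, hg0, hg⟩ := hind N le_rfl
  rw [div_self hNpos.ne'] at hgc hg
  exact ⟨g, hgc, hg0, fun t ht => (hg t ht).1⟩

/-- Endpoints of lifted segments issuing from `f 0` define a section `σ` of `f`. Uniqueness of lifts
makes it continuous and two-sided. -/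
theorem IsLocalHomeomorph.isHomeomorph_of_exists_segment_lift {E : Type*}
    [NormedAddCommGroup E] [NormedSpace ℝ E] {f : E → E} (hf : IsLocalHomeomorph f)
    (hlift : ∀ x v, ∃ g : ℝ → E, ContinuousOn g (Set.Icc 0 1) ∧ g 0 = x ∧
      ∀ t ∈ Set.Icc (0 : ℝ) 1, f (g t) = f x + t • v) : IsHomeomorph f := by
  have hsep : IsSeparatedMap f := T2Space.isSeparatedMap f
  choose g hgc hg0 hg using fun v => hlift 0 v
  let G : unitInterval × E → E := fun p => g (p.2 - f 0) p.1
  have hGc : ∀ y, Continuous fun t : unitInterval => G (t, y) := fun y =>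
    (hgc (y - f 0)).comp_continuous continuous_subtype_val fun t => t.2
  -- A lift through a separated local homeomorphism is jointly continuous once it is continuous in
  -- time and at time `0`, where it is constant here.
  have hG : Continuous G := by
    refine hf.continuous_lift hsep
      ⟨fun p : unitInterval × E => f 0 + (p.1 : ℝ) • (p.2 - f 0), by fun_prop⟩
      (funext fun p => hg _ _ p.1.2) ?_ hGc
    simpa [G, hg0] using continuous_const
  let σ : E → E := fun y => G (1, y)
  have hσc : Continuous σ := hG.comp (by fun_prop)
  have hfσ : ∀ y, f (σ y) = y := fun y => by
    have := hg (y - f 0) 1 (by simp)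
    simpa [σ, G] using this
  have hσ0 : σ (f 0) = 0 := by
    have : (fun t : unitInterval => G (t, f 0)) = fun _ => 0 := by
      refine hsep.eq_of_comp_eq hf.isLocallyInjective (hGc _) continuous_const
        (funext fun t => ?_) 0 (by simp [G, hg0])
      simpa [G] using hg (f 0 - f 0) t t.2
    exact congrFun this 1
  -- Both maps lift `f` through itself and agree at `0`, hence agree on the connected space `E`.
  have hσf : σ ∘ f = id := hsep.eq_of_comp_eq hf.isLocallyInjective (hσc.comp hf.continuous)
    continuous_id (funext fun x => hfσ (f x)) 0 hσ0
  exact (Homeomorph.mk ⟨f, σ, congrFun hσf, hfσ⟩ hf.continuous hσc).isHomeomorph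

/-! ### Expansion and ascent from Clarke bounds. -/

section ClarkeInverse

variable {n : ℕ} {f : EuclideanSpace ℝ (Fin n) → EuclideanSpace ℝ (Fin n)} {K : NNReal}

/-- If the Clarke differential at `x` is bounded below on the pair `(w, v)`, then `⟪w, f⟫` grows at
half that rate in the direction `v`, on a ball independent of the pair. -/
theorem exists_ball_forall_le_inner_sub (hf : LipschitzWith K f) (x : EuclideanSpace ℝ (Fin n))
    {c : ℝ} (hc : 0 < c) :
    ∃ r > 0, ∀ v w : EuclideanSpace ℝ (Fin n), ‖v‖ = 1 → ‖w‖ = 1 →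
      (∀ A ∈ clarkeDifferential f x, c ≤ inner ℝ w (A v)) →
      ∀ (t : ℝ) (y : EuclideanSpace ℝ (Fin n)), 0 ≤ t → y ∈ Metric.ball x r →
        y + t • v ∈ Metric.ball x r → c / 2 * t ≤ inner ℝ w (f (y + t • v) - f y) := by
  -- Tolerance `c / 2` leaves half the rate, and the radius depends only on `x` and `c`, never on
  -- the pair of vectors.
  obtain ⟨r, hr, hnear⟩ := exists_ball_fderiv_near_clarkeDifferential hf x (half_pos hc)
  refine ⟨r, hr, fun v w hv hw hA t y ht hy hyt => ?_⟩
  have hφ : LipschitzWith (‖innerSL ℝ w‖₊ * K) fun y => inner ℝ w (f y) :=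
    (innerSL ℝ w).lipschitz.comp hf
  rw [inner_sub_right]
  refine hφ.le_sub_of_ae_le_fderiv MeasureTheory.volume Metric.isOpen_ball
    (convex_ball x r) ?_ hy hyt
  filter_upwards [hf.ae_differentiableAt (μ := MeasureTheory.volume)] with z hz hzr
  obtain ⟨A, hAmem, hAz⟩ := hnear z hzr hz
  have hderiv : fderiv ℝ (fun y => inner ℝ w (f y)) z = (innerSL ℝ w).comp (fderiv ℝ f z) :=
    ((innerSL ℝ w).hasFDerivAt.comp z hz.hasFDerivAt).fderiv
  have h1 : |inner ℝ w ((fderiv ℝ f z - A) v)| ≤ c / 2 := by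
    refine (abs_real_inner_le_norm _ _).trans ?_
    rw [hw, one_mul]
    refine ((fderiv ℝ f z - A).le_opNorm v).trans ?_
    rw [hv, mul_one]
    exact hAz.le
  rw [sub_apply, inner_sub_right] at h1
  have h2 := hA A hAmem
  have h3 := (abs_le.1 h1).1
  have h4 : c / 2 ≤ inner ℝ w (fderiv ℝ f z v) := by linarith
  rw [hderiv, ContinuousLinearMap.comp_apply, map_smul, map_smul, smul_eq_mul, innerSL_apply_apply,
    mul_comm]
  exact mul_le_mul_of_nonneg_left h4 ht

theorem convex_image_clarkeDifferential {F : Type*} [AddCommGroup F] [Module ℝ F]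
    (x : EuclideanSpace ℝ (Fin n))
    (T : (EuclideanSpace ℝ (Fin n) →L[ℝ] EuclideanSpace ℝ (Fin n)) →ₗ[ℝ] F) :
    Convex ℝ (T '' clarkeDifferential f x) :=
  (convex_convexHull ℝ _).linear_image T

/-- Local expansion for a Lipschitz map whose Clarke differential is bounded below. -/
theorem exists_ball_local_expansion [Nontrivial (EuclideanSpace ℝ (Fin n))]
    (hf : LipschitzWith K f) (x : EuclideanSpace ℝ (Fin n)) {c : ℝ} (hc : 0 < c)
    (hA : ∀ A ∈ clarkeDifferential f x, ∀ v, c * ‖v‖ ≤ ‖A v‖) :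
    ∃ r > 0, ∀ y ∈ Metric.ball x r, ∀ z ∈ Metric.ball x r,
      c / 2 * ‖y - z‖ ≤ ‖f y - f z‖ := by
  obtain ⟨r, hr, hgrow⟩ := exists_ball_forall_le_inner_sub hf x hc
  refine ⟨r, hr, fun y hy z hz => ?_⟩
  obtain rfl | hne := eq_or_ne y z
  · simp
  have hpos : 0 < ‖y - z‖ := norm_pos_iff.2 (sub_ne_zero.2 hne)
  set v := ‖y - z‖⁻¹ • (y - z) with hvdef
  have hv : ‖v‖ = 1 := by simp [hvdef, norm_smul, hpos.ne']
  have hzv : z + ‖y - z‖ • v = y := by simp [hvdef, smul_smul, hpos.ne']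
  obtain ⟨w, hw, hwA⟩ := (convex_image_clarkeDifferential (f := f) x
    (ContinuousLinearMap.apply ℝ _ v).toLinearMap).exists_unit_forall_le_inner hc (by
      rintro _ ⟨A, hAm, rfl⟩
      simpa [hv] using hA A hAm v)
  have h := hgrow v w hv hw (fun A hAm => hwA _ ⟨A, hAm, rfl⟩) ‖y - z‖ z (norm_nonneg _) hz
    (by rwa [hzv])
  rw [hzv] at h
  refine h.trans ((real_inner_le_norm _ _).trans_eq ?_)
  rw [hw, one_mul]

/-- Ascent in every direction for a Lipschitz map whose Clarke differential has adjoints bounded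
below. -/
theorem exists_directional_ascent [Nontrivial (EuclideanSpace ℝ (Fin n))]
    (hf : LipschitzWith K f) (x : EuclideanSpace ℝ (Fin n)) {c : ℝ} (hc : 0 < c)
    (hA : ∀ A ∈ clarkeDifferential f x, ∀ w, c * ‖w‖ ≤ ‖A.adjoint w‖)
    {w : EuclideanSpace ℝ (Fin n)} (hw : ‖w‖ = 1) :
    ∃ v : EuclideanSpace ℝ (Fin n), ‖v‖ = 1 ∧ ∃ r > 0, ∀ t ∈ Set.Ioo (0 : ℝ) r,
      c / 2 * t ≤ inner ℝ w (f (x + t • v) - f x) := by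
  obtain ⟨r, hr, hgrow⟩ := exists_ball_forall_le_inner_sub hf x hc
  -- Separating the vectors `A* w` rather than `A v` fixes the target direction `w` and yields a
  -- common direction of motion `v`.
  let T : (EuclideanSpace ℝ (Fin n) →L[ℝ] EuclideanSpace ℝ (Fin n)) →ₗ[ℝ]
      EuclideanSpace ℝ (Fin n) :=
    { toFun := fun A => A.adjoint w
      map_add' := fun A B => by simp
      map_smul' := fun a A => by simp }
  obtain ⟨v, hv, hvA⟩ := (convex_image_clarkeDifferential (f := f) x
    T).exists_unit_forall_le_inner hc (by
      rintro _ ⟨A, hAm, rfl⟩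
      simpa [hw, T] using hA A hAm w)
  refine ⟨v, hv, r, hr, fun t ht => hgrow v w hv hw (fun A hAm => ?_) t x ht.1.le
    (Metric.mem_ball_self hr) ?_⟩
  · rw [← A.adjoint_inner_left, real_inner_comm]
    exact hvA _ ⟨A, hAm, rfl⟩
  · rw [mem_ball_iff_norm, add_sub_cancel_left, norm_smul, hv, mul_one,
      Real.norm_of_nonneg ht.1.le]
    exact ht.2

end ClarkeInverse

/-! ### The global homeomorphism theorem. -/

theorem mainTheorem4 (n : ℕ) (f : EuclideanSpace ℝ (Fin n) → EuclideanSpace ℝ (Fin n))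
    (hf : ∃ K : NNReal, LipschitzWith K f)
    (hrank : ∀ x, HasMaximalRank (clarkeDifferential f x))
    (ε : ℝ) (hε : 0 < ε)
    (hspec : ∀ x, complexSpec (clarkeDifferential f x) ∩ {z : ℂ | ‖z‖ ≤ ε} = ∅) :
    IsHomeomorph f := by
  obtain ⟨K, hf⟩ := hf
  obtain hsub | hnt := subsingleton_or_nontrivial (EuclideanSpace ℝ (Fin n))
  · rw [Subsingleton.elim f id]
    exact (Homeomorph.refl _).isHomeomorph
  obtain ⟨c, hc, hbelow⟩ := exists_forall_mul_norm_le_of_det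
    (E := EuclideanSpace ℝ (Fin n)) K (pow_pos hε n)
  have hdet : ∀ x, ∀ A ∈ clarkeDifferential f x, ε ^ n ≤ |A.det| := fun x A hA =>
    pow_le_abs_det_of_complexSpec hε.le (hspec x) hA
  have hA : ∀ x, ∀ A ∈ clarkeDifferential f x, ∀ v, c * ‖v‖ ≤ ‖A v‖ := fun x A hA =>
    hbelow A (norm_le_of_mem_clarkeDifferential hf hA) (hdet x A hA)
  have hadj : ∀ x, ∀ A ∈ clarkeDifferential f x, ∀ w, c * ‖w‖ ≤ ‖A.adjoint w‖ :=
    fun x A hAm => ContinuousLinearMap.mul_norm_le_norm_adjoint hc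
      (ContinuousLinearMap.surjective_of_det_ne_zero
        (abs_pos.1 ((pow_pos hε n).trans_le (hdet x A hAm)))) (hA x A hAm)
  -- The minimisation needs a slope strictly below the ascent rate `c / 2`; the expansion constant
  -- is weakened to the same `c / 4` so that lifting uses a single constant.
  have hsol := exists_eq_of_directional_ascent hf (a := c / 4) (b := c / 2) (by positivity)
    (by linarith) fun x w hw => exists_directional_ascent hf x hc (hadj x) hw
  have hloc : ∀ x, ∃ r > 0, ∀ y ∈ Metric.ball x r, ∀ z ∈ Metric.ball x r,
      c / 4 * ‖y - z‖ ≤ ‖f y - f z‖ := fun x => by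
    obtain ⟨r, hr, h⟩ := exists_ball_local_expansion hf x hc (hA x)
    refine ⟨r, hr, fun y hy z hz => le_trans ?_ (h y hy z hz)⟩
    gcongr
    norm_num
  have hc4 : 0 < c / 4 := by positivity
  exact (isLocalHomeomorph_of_local_expansion hc4 hf.continuous
    (isOpenMap_of_exists_eq hc4 hsol) hloc).isHomeomorph_of_exists_segment_lift
    (exists_segment_lift hc4 hsol hloc)
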